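/- Let $p\ge 1$, let $\mathbb{k}$ be an arbitrary field, and let $R=\bigoplus_{\nu\in\mathbb{N}^p}[R]_\nu$ be a finitely generated standard $\mathbb{N}^p$-graded $\mathbb{k}$-algebra: $R$ is a commutative ring, $[R]_{\mathbf 0}=\mathbb{k}$, and $R$ is generated over $\mathbb{k}$ by finitely many elements, each of degree one of the elementary vectors $\mathbf{e}_1,\dots,\mathbf{e}_p$. Let $\mathfrak{m}_i\subset R$ be the ideal generated by $[R]_{\mathbf{e}_i}$, let $\mathfrak{N}=\mathfrak{m}_1\cap\dots\cap\mathfrak{m}_p$, and let $$X=\mathrm{MultiProj}(R)=\{\mathfrak{P}\in\mathrm{Spec}(R)\mid \mathfrak{P}\text{ is }\mathbb{N}^p\text{-graded and }\mathfrak{P}\not\supseteq\mathfrak{N}\}$$ with the Zariski topology; assume $X\neq\emptyset$. For $J\subseteq\{1,\dots,p\}$ let $R_{(J)}=\bigoplus_{\nu_i=0\text{ for }i\notin J}[R]_\nu$, a standard $\mathbb{N}^J$-graded $\mathbb{k}$-algebra, and let $\Pi_J\colon X\to X_J=\mathrm{MultiProj}(R_{(J)})$, $\mathfrak{P}\mapsto\mathfrak{P}\cap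 R_{(J)}$, be the natural projection. There is a unique polynomial $P_R\in\mathbb{Q}[t_1,\dots,t_p]$, the Hilbert polynomial of $R$, such that $P_R(\nu)=\dim_{\mathbb{k}}[R]_\nu$ for all $\nu\in\mathbb{N}^p$ with all coordinates sufficiently large. For every $J\subseteq\{1,\dots,p\}$, let $\deg(P_R;J)$ be the degree of $P_R$ in the variables $t_j$, $j\in J$, that is, the maximum of $\sum_{j\in J}n_j$ over the monomials $t_1^{n_1}\cdots t_p^{n_p}$ occurring in $P_R$. Then $$\deg(P_R;J)=\dim\big(\Pi_J(X)\big),$$ where $\Pi_J(X)\subseteq X_J$ is the image of $\Pi_J$ and $\dim$ is its Krull dimension as a topological space. -/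

import Mathlib

/-!
Standard `ℕ^p`-graded algebras over a field, multiprojective spectra, their natural projections,
and multigraded Hilbert polynomials.
-/

namespace MultigradedAlgebra

universe u v

section Basic

variable {k : Type u} {R : Type v} [Field k] [CommRing R] [Algebra k R]
variable {ι : Type*} [Fintype ι] [DecidableEq ι]

/-- An `ℕ^ι`-graded `k`-algebra `R` is (finitely generated and) *standard* if `[R]_0 = k` and `R` is
generated as a `k`-algebra by finitely many elements, each of degree some elementary vector. -/
structure IsStandard (𝒜 : (ι → ℕ) → Submodule k R) : Prop where
  algebraMap_injective : Function.Injective (algebraMap k R)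
  degree_zero : (𝒜 0 : Set R) = Set.range (algebraMap k R)
  generated : ∃ s : Finset R, (∀ x ∈ s, ∃ i, x ∈ 𝒜 (Pi.single i 1)) ∧
    Algebra.adjoin k (s : Set R) = ⊤

/-- The ideal `𝔪_i` of `R` generated by `[R]_{e_i}`. -/
def partIdeal (𝒜 : (ι → ℕ) → Submodule k R) (i : ι) : Ideal R :=
  Ideal.span (𝒜 (Pi.single i 1) : Set R)

/-- The multigraded irrelevant ideal: the intersection of all the `𝔪_i`. -/
def irrelevant (𝒜 : (ι → ℕ) → Submodule k R) : Ideal R :=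
  ⨅ i, partIdeal 𝒜 i

/-- The (underlying space of the) multiprojective scheme of `R`: the multigraded prime ideals that do
not contain the irrelevant ideal, with the Zariski topology (the subspace topology of `Spec R`). -/
abbrev MultiProj (𝒜 : (ι → ℕ) → Submodule k R) [GradedAlgebra 𝒜] : Type v :=
  {P : PrimeSpectrum R // P.asIdeal.IsHomogeneous 𝒜 ∧ ¬ irrelevant 𝒜 ≤ P.asIdeal}

/-- `P` is the Hilbert polynomial: `P(ν) = dim_k [R]_ν` for all `ν ≫ 0`. -/
def IsHilbertPolynomial (𝒜 : (ι → ℕ) → Submodule k R) (P : MvPolynomial ι ℚ) : Prop :=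
  ∃ w : ι → ℕ, ∀ ν : ι → ℕ, w ≤ ν →
    MvPolynomial.eval (fun i => (ν i : ℚ)) P = (Module.finrank k (𝒜 ν) : ℚ)

end Basic

/-- The degree of a polynomial in the variables `t_j`, `j ∈ J` (the other variables being treated as
constants). -/
def degreeIn {ι : Type*} (J : Finset ι) (P : MvPolynomial ι ℚ) : ℕ :=
  P.support.sup fun m => ∑ j ∈ J, m j

section Restrict

variable {k : Type u} {R : Type v} [Field k] [CommRing R] [Algebra k R]
variable {ι : Type*} [DecidableEq ι]

/-- Extension by zero of a multidegree supported on `J`. -/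
def extendDeg (J : Finset ι) (μ : J → ℕ) : ι → ℕ :=
  fun i => if h : i ∈ J then μ ⟨i, h⟩ else 0

theorem extendDeg_injective (J : Finset ι) : Function.Injective (extendDeg J) := by
  intro μ μ' h
  ext j
  have := congrFun h j
  simpa [extendDeg] using this

theorem extendDeg_zero (J : Finset ι) : extendDeg J 0 = 0 := by
  ext i; simp [extendDeg]

theorem extendDeg_add (J : Finset ι) (μ μ' : J → ℕ) :
    extendDeg J (μ + μ') = extendDeg J μ + extendDeg J μ' := by
  ext i; by_cases h : i ∈ J <;> simp [extendDeg, h]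

theorem extendDeg_single (J : Finset ι) (j : J) :
    extendDeg J (Pi.single j 1) = Pi.single (j : ι) 1 := by
  ext i
  by_cases h : i ∈ J
  · by_cases hij : i = j
    · subst hij; simp [extendDeg]
    · have : (⟨i, h⟩ : J) ≠ j := fun e => hij (by rw [← e])
      simp [extendDeg, h, hij, this]
  · have : i ≠ j := fun e => h (e ▸ j.2)
    simp [extendDeg, h, this]

variable [Fintype ι] (𝒜 : (ι → ℕ) → Submodule k R) [GradedAlgebra 𝒜] (J : Finset ι)

/-- The subalgebra `R_(J)` of `R`: the sum of the components `[R]_ν` over the multidegrees `ν` with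
`ν_i = 0` for all `i ∉ J`. -/
def supportedSubalgebra : Subalgebra k R :=
  (⨆ μ : J → ℕ, 𝒜 (extendDeg J μ)).toSubalgebra
    (Submodule.mem_iSup_of_mem 0 (by rw [extendDeg_zero]; exact SetLike.GradedOne.one_mem))
    (by
      intro x y hx hy
      refine Submodule.iSup_induction _ (motive := fun x => x * y ∈ _) hx ?_ (by simp)
        (fun a b ha hb => by rw [add_mul]; exact add_mem ha hb)
      intro μ x hx
      refine Submodule.iSup_induction _ (motive := fun y => x * y ∈ _) hy ?_ (by simp)
        (fun a b ha hb => by rw [mul_add]; exact add_mem ha hb)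
      intro μ' y hy
      exact Submodule.mem_iSup_of_mem (μ + μ')
        (by rw [extendDeg_add]; exact SetLike.GradedMul.mul_mem hx hy))

/-- The `ℕ^J`-grading of `R_(J)`. -/
def subgrading (μ : J → ℕ) : Submodule k (supportedSubalgebra 𝒜 J) :=
  (𝒜 (extendDeg J μ)).comap (supportedSubalgebra 𝒜 J).val.toLinearMap

theorem map_subgrading (μ : J → ℕ) :
    (subgrading 𝒜 J μ).map (supportedSubalgebra 𝒜 J).val.toLinearMap = 𝒜 (extendDeg J μ) := by
  ext x
  constructor
  · rintro ⟨y, hy, rfl⟩; exact hy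
  · intro hx
    exact ⟨⟨x, Submodule.mem_iSup_of_mem (p := fun μ : J → ℕ => 𝒜 (extendDeg J μ)) μ hx⟩, hx, rfl⟩

theorem subgrading_isInternal : DirectSum.IsInternal (subgrading 𝒜 J) := by
  have hinj : Function.Injective (supportedSubalgebra 𝒜 J).val.toLinearMap := Subtype.val_injective
  have hind : iSupIndep fun μ : J → ℕ => 𝒜 (extendDeg J μ) :=
    (DirectSum.Decomposition.isInternal 𝒜).submodule_iSupIndep.comp (extendDeg_injective J)
  refine DirectSum.isInternal_submodule_of_iSupIndep_of_iSup_eq_top ?_ ?_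
  · rw [iSupIndep_def] at hind ⊢
    intro μ
    have h := hind μ
    simp only [← map_subgrading 𝒜 J, ← Submodule.map_iSup] at h
    rw [Submodule.disjoint_def] at h ⊢
    intro x hx hx'
    exact hinj ((h _ (Submodule.mem_map_of_mem hx) (Submodule.mem_map_of_mem hx')).trans
      (map_zero _).symm)
  · apply Submodule.map_injective_of_injective hinj
    rw [Submodule.map_iSup]
    simp only [map_subgrading]
    ext x
    constructor
    · intro hx; exact ⟨⟨x, hx⟩, trivial, rfl⟩
    · rintro ⟨y, -, rfl⟩; exact y.2

instance subgrading_gradedMonoid : SetLike.GradedMonoid (subgrading 𝒜 J) where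
  one_mem := by
    change (1 : R) ∈ 𝒜 (extendDeg J 0)
    rw [extendDeg_zero]; exact SetLike.GradedOne.one_mem
  mul_mem := by
    intro μ μ' x y hx hy
    change (x * y : R) ∈ 𝒜 (extendDeg J (μ + μ'))
    rw [extendDeg_add]; exact SetLike.GradedMul.mul_mem hx hy

noncomputable instance subgrading_gradedAlgebra : GradedAlgebra (subgrading 𝒜 J) where
  toDecomposition := (subgrading_isInternal 𝒜 J).chooseDecomposition

theorem coe_decompose (x : supportedSubalgebra 𝒜 J) (μ : J → ℕ) :
    ((DirectSum.decompose (subgrading 𝒜 J) x μ : supportedSubalgebra 𝒜 J) : R) =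
      (DirectSum.decompose 𝒜 (x : R) (extendDeg J μ) : R) := by
  induction x using DirectSum.Decomposition.inductionOn (subgrading 𝒜 J) with
  | zero => simp
  | @homogeneous i m =>
    have hm : ((m : supportedSubalgebra 𝒜 J) : R) ∈ 𝒜 (extendDeg J i) := m.2
    rw [DirectSum.decompose_of_mem _ m.2, DirectSum.decompose_of_mem _ hm]
    by_cases h : i = μ
    · subst h; simp
    · rw [DirectSum.of_eq_of_ne _ _ _ (Ne.symm h),
        DirectSum.of_eq_of_ne _ _ _ (fun e => h (extendDeg_injective J e).symm)]
      simp
  | add a b ha hb => simp [DirectSum.decompose_add, ha, hb]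

theorem comap_mem_multiProj (P : MultiProj 𝒜) :
    (Ideal.comap (supportedSubalgebra 𝒜 J).val P.1.asIdeal).IsHomogeneous (subgrading 𝒜 J) ∧
      ¬ irrelevant (subgrading 𝒜 J) ≤ Ideal.comap (supportedSubalgebra 𝒜 J).val P.1.asIdeal := by
  constructor
  · intro μ x hx
    change ((DirectSum.decompose (subgrading 𝒜 J) x μ : supportedSubalgebra 𝒜 J) : R) ∈ P.1.asIdeal
    rw [coe_decompose]
    exact P.2.1 _ hx
  · intro h
    have hprime : (Ideal.comap (supportedSubalgebra 𝒜 J).val P.1.asIdeal).IsPrime :=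
      Ideal.comap_isPrime _ _
    have h' : Finset.univ.inf (partIdeal (subgrading 𝒜 J)) ≤
        Ideal.comap (supportedSubalgebra 𝒜 J).val P.1.asIdeal := by
      rw [Finset.inf_univ_eq_iInf]; exact h
    obtain ⟨j, -, hj⟩ := hprime.inf_le'.1 h'
    refine P.2.2 ((iInf_le _ (j : ι)).trans (Ideal.span_le.2 fun x hx => ?_))
    rw [SetLike.mem_coe, ← extendDeg_single J j] at hx
    have hxJ : x ∈ supportedSubalgebra 𝒜 J :=
      Submodule.mem_iSup_of_mem (p := fun μ : J → ℕ => 𝒜 (extendDeg J μ)) (Pi.single j 1) hx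
    have hx' : (⟨x, hxJ⟩ : supportedSubalgebra 𝒜 J) ∈ partIdeal (subgrading 𝒜 J) j :=
      Ideal.subset_span hx
    exact hj hx'

/-- The natural projection `Π_J : MultiProj R → MultiProj R_(J)`, `P ↦ P ∩ R_(J)`. -/
def projection (P : MultiProj 𝒜) : MultiProj (subgrading 𝒜 J) :=
  ⟨PrimeSpectrum.comap (supportedSubalgebra 𝒜 J).val.toRingHom P.1, comap_mem_multiProj 𝒜 J P⟩

end Restrict

end MultigradedAlgebra

/-!
For a homogeneous ideal `I` let `H_I(ν)` be the dimension of the degree `ν` part of `R ⧸ I`. For `a`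
homogeneous of degree `c`, multiplication by `a` gives
`H_I(ν + c) = H_{I : a}(ν) + H_{I + (a)}(ν + c)` (`hilbertFunction_add`), and everything rests on
this identity.

*Existence of the Hilbert polynomial* (`IsStandard.exists_hilbertPolynomial`) follows for all
homogeneous ideals by Noetherian induction, because a function with polynomial partial differences
is polynomial (`exists_eventuallyEval_of_difference`).

*The dimension as a length of chains.* `MultiProj R` is Noetherian and sober, hence so is its image
under `Π_J`, and the dimension of the image is the supremum of the lengths of chains of primes of
`R_(J)` of the form `P ∩ R_(J)`, with `P` in `MultiProj R`
(`topologicalKrullDim_range_projection`). Neither closedness of the image nor dimension theory of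
finitely generated algebras is needed.

*The degree in the variables of `J`* is measured on lines whose direction is supported on `J`
(`ReachesDegree`). This notion is visibly compatible with sums and translations, and drops by one
under a suitable difference.

*Chains are not too long* (`reachesDegree_of_ltSeries`). For a chain `Q_0 < ⋯ < Q_n` of relevant
homogeneous primes of `R_(J)`, an element of `Q_1 \ Q_0` of degree `(M, …, M)` shows by induction that
the Hilbert function of `R_(J) ⧸ Q_0` at `(s M, …, s M)` is at least `s.choose n`
(`choose_le_hilbertFunction`). If `Q_0 = P ∩ R_(J)`, multiplication by an element outside `P` embeds
this space into a component of `R ⧸ P` that is large also in the remaining degrees, so that the Hilbert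
polynomial of `R` grows at least as `s ^ n` on a line.

*Long chains exist* (`exists_ltSeries_of_reachesDegree`). By Noetherian induction on `I`: if `I` is not
prime, there is a homogeneous `a` for which `I : a` and `I + (a)` are larger than `I`, and one of them
has the same degree in the variables of `J`; if `I` is prime, of degree `d`, then `I + (f)` has degree
at least `d - 1` for some homogeneous `f ∈ R_(J) \ I`, and `I ∩ R_(J)` can be put below a chain obtained for
`I + (f)`.
-/

namespace MultigradedAlgebra

universe u v

/-! ### Polynomials at large multidegrees, and degrees in part of the variables -/

section Polynomials

open MvPolynomial

variable {ι : Type*}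

/-- The polynomial `P` takes the values of `F` at all sufficiently large multidegrees. -/
def EventuallyEval (F : (ι → ℕ) → ℚ) (P : MvPolynomial ι ℚ) : Prop :=
  ∃ w : ι → ℕ, ∀ ν : ι → ℕ, w ≤ ν → eval (fun i => (ν i : ℚ)) P = F ν

theorem eq_of_eval_eq_of_le [Finite ι] {P Q : MvPolynomial ι ℚ} (w : ι → ℕ)
    (h : ∀ ν : ι → ℕ, w ≤ ν → eval (fun i => (ν i : ℚ)) P = eval (fun i => (ν i : ℚ)) Q) :
    P = Q := by
  refine funext_set (fun i => (Nat.cast : ℕ → ℚ) '' Set.Ici (w i))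
    (fun i => (Set.Ici_infinite (w i)).image Nat.cast_injective.injOn) fun x hx => ?_
  choose ν hν hνx using fun i => hx i (Set.mem_univ i)
  obtain rfl : (fun i => (ν i : ℚ)) = x := funext hνx
  exact h ν hν

theorem EventuallyEval.unique [Finite ι] {F : (ι → ℕ) → ℚ} {P Q : MvPolynomial ι ℚ}
    (hP : EventuallyEval F P) (hQ : EventuallyEval F Q) : P = Q := by
  obtain ⟨w, hw⟩ := hP
  obtain ⟨w', hw'⟩ := hQ
  exact eq_of_eval_eq_of_le (w ⊔ w') fun ν hν =>
    (hw ν (le_sup_left.trans hν)).trans (hw' ν (le_sup_right.trans hν)).symm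

theorem EventuallyEval.add {F G : (ι → ℕ) → ℚ} {P Q : MvPolynomial ι ℚ}
    (hP : EventuallyEval F P) (hQ : EventuallyEval G Q) : EventuallyEval (F + G) (P + Q) := by
  obtain ⟨w, hw⟩ := hP
  obtain ⟨w', hw'⟩ := hQ
  refine ⟨w ⊔ w', fun ν hν => ?_⟩
  rw [map_add, hw ν (le_sup_left.trans hν), hw' ν (le_sup_right.trans hν), Pi.add_apply]

/-- The polynomial `P(t + c)`. -/
noncomputable def translate (c : ι → ℕ) (P : MvPolynomial ι ℚ) : MvPolynomial ι ℚ :=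
  aeval (fun i => X i + C (c i : ℚ)) P

theorem eval_aeval (x : ι → ℚ) (σ : ι → MvPolynomial ι ℚ) (P : MvPolynomial ι ℚ) :
    eval x (aeval σ P) = eval (fun i => eval x (σ i)) P := by
  induction P using MvPolynomial.induction_on with
  | C r => simp
  | add p q hp hq => rw [map_add, map_add, map_add, hp, hq]
  | mul_X p i hp => rw [map_mul, map_mul, map_mul, hp, aeval_X, eval_X]

theorem eval_translate (c : ι → ℕ) (P : MvPolynomial ι ℚ) (x : ι → ℚ) :
    eval x (translate c P) = eval (fun i => x i + c i) P := by
  rw [translate, eval_aeval]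
  simp

theorem EventuallyEval.translate {F : (ι → ℕ) → ℚ} {P : MvPolynomial ι ℚ}
    (hP : EventuallyEval F P) (c : ι → ℕ) :
    EventuallyEval (fun ν => F (ν + c)) (translate c P) := by
  obtain ⟨w, hw⟩ := hP
  refine ⟨w, fun ν hν => ?_⟩
  rw [eval_translate]
  simpa using hw (ν + c) (hν.trans le_self_add)

theorem exists_eventuallyEval_of_add_right {F : (ι → ℕ) → ℚ} {P : MvPolynomial ι ℚ} (c : ι → ℕ)
    (hP : EventuallyEval (fun ν => F (ν + c)) P) : ∃ Q, EventuallyEval F Q := by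
  obtain ⟨w, hw⟩ := hP
  refine ⟨aeval (fun i => X i - C (c i : ℚ)) P, w + c, fun ν hν => ?_⟩
  obtain ⟨μ, rfl⟩ : ∃ μ, ν = μ + c :=
    ⟨ν - c, (tsub_add_cancel_of_le (le_add_self.trans hν)).symm⟩
  rw [eval_aeval]
  simpa using hw μ (le_of_add_le_add_right hν)

/-- A discrete antiderivative in the variable `t_i` exists: for a power `t_i ^ n` it is the
Bernoulli polynomial of index `n + 1`, divided by `n + 1`. -/
theorem exists_antidifference [Fintype ι] [DecidableEq ι] (i : ι) (G : MvPolynomial ι ℚ) :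
    ∃ K : MvPolynomial ι ℚ, ∀ x : ι → ℚ,
      eval (Function.update x i (1 + x i)) K - eval x K = eval x G := by
  induction G using MvPolynomial.induction_on' with
  | monomial m r =>
    refine ⟨C (r / (m i + 1)) * Polynomial.aeval (X i) (Polynomial.bernoulli (m i + 1)) *
      ∏ l ∈ Finset.univ.erase i, X l ^ m l, fun x => ?_⟩
    have hev : ∀ y : ι → ℚ, eval y (Polynomial.aeval (X i) (Polynomial.bernoulli (m i + 1)) :
        MvPolynomial ι ℚ) = (Polynomial.bernoulli (m i + 1)).eval (y i) := by
      intro y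
      rw [← MvPolynomial.coe_aeval_eq_eval, RingHom.coe_coe, ← Polynomial.aeval_algHom_apply]
      simp
    have hprod : ∏ l ∈ Finset.univ.erase i, Function.update x i (1 + x i) l ^ m l =
        ∏ l ∈ Finset.univ.erase i, x l ^ m l :=
      Finset.prod_congr rfl fun l hl => by
        rw [Function.update_of_ne (Finset.ne_of_mem_erase hl)]
    have hm : eval x (monomial m r) = r * (x i ^ m i * ∏ l ∈ Finset.univ.erase i, x l ^ m l) := by
      rw [eval_monomial, Finsupp.prod_fintype _ _ (by simp),
        Finset.mul_prod_erase _ (fun l => x l ^ m l) (Finset.mem_univ i)]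
    simp only [map_mul, map_prod, map_pow, eval_X, eval_C, hev, hprod, hm, Function.update_self,
      Polynomial.bernoulli_eval_one_add]
    have : (m i + 1 : ℚ) ≠ 0 := by positivity
    push_cast
    field_simp
    simp only [add_sub_cancel_left]
    ring
  | add p q hp hq =>
    obtain ⟨K, hK⟩ := hp
    obtain ⟨L, hL⟩ := hq
    refine ⟨K + L, fun x => ?_⟩
    rw [map_add, map_add, map_add, ← hK x, ← hL x]
    ring

/-- A function all of whose partial differences are polynomial in large multidegrees is itself
polynomial in large multidegrees. -/
theorem exists_eventuallyEval_of_difference [Fintype ι] [DecidableEq ι] (F : (ι → ℕ) → ℚ)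
    (h : ∀ i, ∃ G : MvPolynomial ι ℚ,
      EventuallyEval (fun ν => F (ν + Pi.single i 1) - F ν) G) :
    ∃ P, EventuallyEval F P := by
  choose G w₀ hw₀ using h
  obtain ⟨w, hw⟩ : ∃ w : ι → ℕ, ∀ i, w₀ i ≤ w :=
    ⟨Finset.univ.sup w₀, fun i => Finset.le_sup (Finset.mem_univ i)⟩
  -- The coordinates are released one by one: those outside `T` are frozen at their bound `w`.
  have key : ∀ T : Finset ι, ∃ P : MvPolynomial ι ℚ, ∀ ν : ι → ℕ, w ≤ ν → (∀ i ∉ T, ν i = w i) →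
      eval (fun i => (ν i : ℚ)) P = F ν := by
    intro T
    induction T using Finset.induction_on with
    | empty =>
      refine ⟨C (F w), fun ν _ hT => ?_⟩
      obtain rfl : ν = w := funext fun i => hT i (Finset.notMem_empty i)
      simp
    | insert i T _ ih =>
      obtain ⟨K, hK⟩ := ih
      obtain ⟨L, hL⟩ := exists_antidifference i (G i)
      let σ : ι → MvPolynomial ι ℚ := Function.update X i (C (w i : ℚ))
      refine ⟨L + aeval σ (K - L), fun ν hν hT => ?_⟩
      have hσ : ∀ (ν : ι → ℕ) (Q : MvPolynomial ι ℚ), eval (fun l => (ν l : ℚ)) (aeval σ Q) =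
          eval (fun l => (Function.update ν i (w i) l : ℚ)) Q := by
        intro ν Q
        have : (fun l => eval (fun l => (ν l : ℚ)) (σ l)) =
            fun l => (Function.update ν i (w i) l : ℚ) := by
          funext l
          by_cases hl : l = i
          · subst hl; simp [σ]
          · simp [σ, hl]
        rw [← this, eval_aeval]
      -- `F - L` does not depend on the `i`-th coordinate.
      have hconst : ∀ n : ℕ, ∀ ν : ι → ℕ, w ≤ ν → ν i = w i + n →
          F ν - eval (fun l => (ν l : ℚ)) L = F (Function.update ν i (w i)) -
            eval (fun l => (Function.update ν i (w i) l : ℚ)) L := by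
        intro n
        induction n with
        | zero =>
          intro ν _ h0
          rw [add_zero] at h0
          rw [← h0, Function.update_eq_self]
        | succ n ihn =>
          intro ν hν hn
          set μ : ι → ℕ := Function.update ν i (w i + n) with hμ
          have hμν : ν = μ + Pi.single i 1 := by
            funext l
            by_cases hl : l = i
            · subst hl; simp [hμ, hn, add_assoc]
            · simp [hμ, hl]
          have hwμ : w ≤ μ := by
            intro l
            by_cases hl : l = i
            · subst hl; simp [hμ]
            · simpa [hμ, hl] using hν l
          have h1 := ihn μ hwμ (by simp [hμ])
          have h2 : Function.update μ i (w i) = Function.update ν i (w i) := by simp [hμ]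
          rw [h2] at h1
          rw [← h1]
          have h3 := hw₀ i μ ((hw i).trans hwμ)
          have h4 := hL (fun l => (μ l : ℚ))
          have h5 : Function.update (fun l => (μ l : ℚ)) i (1 + μ i) = fun l => (ν l : ℚ) := by
            funext l
            by_cases hl : l = i
            · subst hl; simp [hμν, add_comm]
            · simp [hμν, hl]
          rw [h5] at h4
          simp only [← hμν] at h3
          linarith
      have h1 := hconst (ν i - w i) ν hν (by have := hν i; simp at this; omega)
      have h2 := hK (Function.update ν i (w i))
        (by
          intro l
          by_cases hl : l = i
          · subst hl; simp
          · simpa [hl] using hν l)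
        (by
          intro l hl
          by_cases hli : l = i
          · subst hli; simp
          · simpa [hli] using hT l (by simp [hl, hli]))
      rw [map_add, hσ, map_sub, h2, ← h1]
      ring
  obtain ⟨P, hP⟩ := key Finset.univ
  exact ⟨P, w, fun ν hν => hP ν hν fun i hi => absurd (Finset.mem_univ i) hi⟩

/-- The restriction `P(s a + b)` of `P` to the line through `b` in the direction `a`. -/
noncomputable def line (a : ι → ℕ) (b : ι → ℚ) : MvPolynomial ι ℚ →ₐ[ℚ] Polynomial ℚ :=
  aeval fun i => Polynomial.C (a i : ℚ) * Polynomial.X + Polynomial.C (b i)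

theorem eval_line (a : ι → ℕ) (b : ι → ℚ) (P : MvPolynomial ι ℚ) (s : ℚ) :
    (line a b P).eval s = eval (fun i => a i * s + b i) P := by
  unfold line
  induction P using MvPolynomial.induction_on with
  | C r => simp
  | add p q hp hq => rw [map_add, Polynomial.eval_add, map_add, hp, hq]
  | mul_X p i hp => rw [map_mul, Polynomial.eval_mul, map_mul, hp]; simp

/-- The restriction of `P` to some line in a direction supported on `J` has degree at least `d`. For
`P ≠ 0` this means `d ≤ degreeIn J P`. -/
def ReachesDegree (J : Finset ι) (d : ℕ) (P : MvPolynomial ι ℚ) : Prop :=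
  ∃ (a : ι → ℕ) (b : ι → ℚ), (∀ i ∉ J, a i = 0) ∧ (d : WithBot ℕ) ≤ (line a b P).degree

variable {J : Finset ι} {d : ℕ}

theorem ReachesDegree.ne_zero {P : MvPolynomial ι ℚ} (h : ReachesDegree J d P) : P ≠ 0 := by
  rintro rfl
  obtain ⟨a, b, -, h⟩ := h
  simp at h

theorem ReachesDegree.or_of_add {P Q : MvPolynomial ι ℚ} (h : ReachesDegree J d (P + Q)) :
    ReachesDegree J d P ∨ ReachesDegree J d Q := by
  obtain ⟨a, b, ha, h⟩ := h
  rw [map_add] at h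
  rcases le_max_iff.1 (h.trans (Polynomial.degree_add_le _ _)) with h | h
  · exact .inl ⟨a, b, ha, h⟩
  · exact .inr ⟨a, b, ha, h⟩

theorem line_translate (a c : ι → ℕ) (b : ι → ℚ) (P : MvPolynomial ι ℚ) :
    line a b (translate c P) = line a (fun i => b i + c i) P :=
  Polynomial.funext fun s => by
    rw [eval_line, eval_line, eval_translate]
    simp only [add_assoc]

theorem reachesDegree_translate_iff {c : ι → ℕ} {P : MvPolynomial ι ℚ} :
    ReachesDegree J d (translate c P) ↔ ReachesDegree J d P := by
  constructor
  · rintro ⟨a, b, ha, h⟩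
    exact ⟨a, _, ha, by rwa [line_translate] at h⟩
  · rintro ⟨a, b, ha, h⟩
    refine ⟨a, fun i => b i - c i, ha, ?_⟩
    rw [line_translate]
    simpa using h

/-- Taking differences lowers the degree of a univariate polynomial by only one. -/
theorem le_degree_comp_X_add_one_sub {q : Polynomial ℚ} (h : ((d + 1 : ℕ) : WithBot ℕ) ≤ q.degree) :
    (d : WithBot ℕ) ≤ (q.comp (Polynomial.X + 1) - q).degree := by
  have hq : q ≠ 0 := by rintro rfl; simp at h
  rw [Polynomial.degree_eq_natDegree hq] at h
  obtain ⟨n, hn⟩ : ∃ n, q.natDegree = n + 1 :=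
    ⟨q.natDegree - 1, by have : d + 1 ≤ q.natDegree := by exact_mod_cast h
                         omega⟩
  have hdn : d ≤ n := by
    have : d + 1 ≤ q.natDegree := by exact_mod_cast h
    omega
  refine (Nat.cast_le.2 hdn).trans (Polynomial.le_degree_of_ne_zero ?_)
  have h1 : (Polynomial.hasseDeriv n q).natDegree < 2 := by
    have := Polynomial.natDegree_hasseDeriv_le q n
    omega
  have h2 : (q.comp (Polynomial.X + 1)).coeff n = q.coeff n + (n + 1) * q.coeff (n + 1) := by
    rw [← Polynomial.C_1, ← Polynomial.taylor_apply, Polynomial.taylor_coeff,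
      Polynomial.eval_eq_sum_range' h1]
    simp [Finset.sum_range_succ, Polynomial.hasseDeriv_coeff, add_comm]
  rw [Polynomial.coeff_sub, h2, add_sub_cancel_left]
  have h3 : q.coeff (n + 1) ≠ 0 := by
    rw [← hn]; exact Polynomial.leadingCoeff_ne_zero.2 hq
  exact mul_ne_zero (by positivity) h3

/-- Passing to the difference in the direction of a suitable line lowers the degree by only one. -/
theorem ReachesDegree.exists_difference {P : MvPolynomial ι ℚ} (h : ReachesDegree J (d + 1) P) :
    ∃ a : ι → ℕ, (∀ i ∉ J, a i = 0) ∧ ReachesDegree J d (translate a P - P) := by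
  obtain ⟨a, b, ha, h⟩ := h
  refine ⟨a, ha, a, b, ha, (le_degree_comp_X_add_one_sub h).trans_eq ?_⟩
  congr 1
  refine Polynomial.funext fun s => ?_
  simp only [Polynomial.eval_sub, Polynomial.eval_comp, map_sub, eval_line, eval_translate,
    Polynomial.eval_add, Polynomial.eval_X, Polynomial.eval_one]
  have : (fun i => (a i : ℚ) * (s + 1) + b i) = fun i => a i * s + b i + a i := by
    funext i
    ring
  rw [this]

theorem ReachesDegree.le_degreeIn {P : MvPolynomial ι ℚ} (h : ReachesDegree J d P) :
    d ≤ degreeIn J P := by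
  obtain ⟨a, b, ha, h⟩ := h
  suffices (line a b P).natDegree ≤ degreeIn J P from
    (Nat.cast_le.1 (h.trans Polynomial.degree_le_natDegree)).trans this
  rw [line, aeval_def, eval₂_eq]
  refine Polynomial.natDegree_sum_le_of_forall_le _ _ fun m hm => ?_
  refine le_trans ?_ (Finset.le_sup (f := fun m : ι →₀ ℕ => ∑ j ∈ J, m j) hm)
  rw [Polynomial.algebraMap_eq]
  refine (Polynomial.natDegree_C_mul_le _ _).trans ((Polynomial.natDegree_prod_le _ _).trans ?_)
  classical
  have : ∀ i ∈ m.support, ((Polynomial.C (a i : ℚ) * Polynomial.X + Polynomial.C (b i)) ^ m i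
      ).natDegree ≤ if i ∈ J then m i else 0 := by
    intro i _
    split_ifs with hi
    · exact (Polynomial.natDegree_pow_le).trans
        ((Nat.mul_le_mul_left _ Polynomial.natDegree_linear_le).trans_eq (mul_one _))
    · rw [ha i hi]
      simp only [Nat.cast_zero, map_zero, zero_mul, zero_add, ← map_pow, Polynomial.natDegree_C,
        le_refl]
  refine (Finset.sum_le_sum this).trans ?_
  rw [← Finset.sum_filter, Finset.filter_mem_eq_inter, Finset.inter_comm]
  exact Finset.sum_le_sum_of_subset Finset.inter_subset_left

theorem reachesDegree_degreeIn [Fintype ι] [DecidableEq ι] (J : Finset ι) {P : MvPolynomial ι ℚ}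
    (hP : P ≠ 0) : ReachesDegree J (degreeIn J P) P := by
  set d := degreeIn J P with hd
  set S := P.support.filter fun m => ∑ j ∈ J, m j = d with hS
  let T : MvPolynomial ι ℚ := ∑ m ∈ S, monomial m (P.coeff m)
  have hT : T ≠ 0 := by
    obtain ⟨m, hm, hmd⟩ := Finset.exists_mem_eq_sup P.support (support_nonempty.2 hP)
      (fun m : ι →₀ ℕ => ∑ j ∈ J, m j)
    intro h0
    have h1 : T.coeff m = P.coeff m := by
      rw [coeff_sum, Finset.sum_eq_single_of_mem m]
      · simp
      · exact Finset.mem_filter.2 ⟨hm, hmd.symm⟩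
      · intro n _ hn
        rw [coeff_monomial, if_neg hn]
    rw [h0, coeff_zero] at h1
    exact mem_support_iff.1 hm h1.symm
  obtain ⟨v, hv⟩ : ∃ v : ι → ℕ, eval (fun i => (v i : ℚ)) T ≠ 0 := by
    by_contra! hcon
    exact hT (eq_of_eval_eq_of_le 0 fun ν _ => by rw [hcon, map_zero])
  -- On the line through the coordinates of `v` outside `J`, in the direction of the coordinates of
  -- `v` in `J`, the coefficient of `s ^ d` is the value at `v` of the top part `T`.
  refine ⟨fun i => if i ∈ J then v i else 0, fun i => if i ∈ J then 0 else (v i : ℚ),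
    fun i hi => if_neg hi, Polynomial.le_degree_of_ne_zero ?_⟩
  convert hv using 1
  have hmon : ∀ m : ι →₀ ℕ, ∏ i, (Polynomial.C ((if i ∈ J then v i else 0 : ℕ) : ℚ) * Polynomial.X +
      Polynomial.C (if i ∈ J then 0 else (v i : ℚ))) ^ m i =
      Polynomial.C (∏ i, (v i : ℚ) ^ m i) * Polynomial.X ^ (∑ j ∈ J, m j) := by
    intro m
    have : ∀ i, (Polynomial.C ((if i ∈ J then v i else 0 : ℕ) : ℚ) * Polynomial.X +
      Polynomial.C (if i ∈ J then 0 else (v i : ℚ))) ^ m i =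
        Polynomial.C ((v i : ℚ) ^ m i) * Polynomial.X ^ (if i ∈ J then m i else 0) := by
      intro i
      split_ifs <;> simp [mul_pow]
    rw [Finset.prod_congr rfl fun i _ => this i, Finset.prod_mul_distrib, ← map_prod,
      Finset.prod_pow_eq_pow_sum, Finset.sum_ite_mem, Finset.univ_inter]
  rw [line, aeval_def, eval₂_eq']
  simp only [hmon, Polynomial.finsetSum_coeff, Polynomial.algebraMap_eq, Polynomial.coeff_C_mul,
    Polynomial.coeff_X_pow, T, map_sum, hS, Finset.sum_filter]
  refine Finset.sum_congr rfl fun m _ => ?_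
  rw [apply_ite (eval _), eval_monomial, Finsupp.prod_fintype _ _ (by simp), map_zero]
  by_cases h : ∑ j ∈ J, m j = d
  · simp [h]
  · rw [if_neg h, if_neg (Ne.symm h), mul_zero, mul_zero]

/-- A polynomial that dominates the binomial coefficients `s.choose n` has degree at least `n`. -/
theorem le_degree_of_choose_le {q : Polynomial ℚ} {n : ℕ}
    (h : ∀ s : ℕ, 1 ≤ s → (s.choose n : ℚ) ≤ q.eval (s : ℚ)) : (n : WithBot ℕ) ≤ q.degree := by
  by_contra! hlt
  have hdeg : (descPochhammer ℚ n).degree = n := by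
    rw [Polynomial.degree_eq_natDegree (monic_descPochhammer ℚ n).ne_zero,
      descPochhammer_natDegree]
  have ht := (Polynomial.div_tendsto_atTop_zero_of_degree_lt q (descPochhammer ℚ n)
    (by rwa [hdeg])).comp (tendsto_natCast_atTop_atTop (R := ℚ))
  have hpos : (0 : ℚ) < 1 / n.factorial := by positivity
  obtain ⟨s, hs, hs'⟩ := ((ht.eventually_lt_const hpos).and
    (Filter.eventually_ge_atTop (n + 1))).exists
  have h1 := h s (by omega)
  have h2 : (0 : ℚ) < (descPochhammer ℚ n).eval (s : ℚ) := by
    rw [descPochhammer_eval_eq_descFactorial]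
    exact_mod_cast Nat.descFactorial_pos.2 (by omega)
  rw [Nat.cast_choose_eq_descPochhammer_div, div_le_iff₀ (by positivity)] at h1
  rw [Function.comp_apply, div_lt_div_iff₀ h2 (by positivity)] at hs
  linarith

end Polynomials

/-! ### Hilbert functions of homogeneous ideals -/

section HilbertFunction

variable {k : Type u} {R : Type v} [Field k] [CommRing R] [Algebra k R]
variable {ι : Type*} (𝒜 : (ι → ℕ) → Submodule k R)

/-- The Hilbert function of `R ⧸ I`, for a homogeneous ideal `I`: the dimension of the image of
`[R]_ν` in `R ⧸ I`. -/
noncomputable def hilbertFunction (I : Ideal R) (ν : ι → ℕ) : ℕ :=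
  Module.finrank k ((𝒜 ν).map (Ideal.Quotient.mkₐ k I).toLinearMap)

theorem hilbertFunction_bot (ν : ι → ℕ) :
    hilbertFunction 𝒜 (⊥ : Ideal R) ν = Module.finrank k (𝒜 ν) := by
  refine (LinearEquiv.finrank_eq (Submodule.equivMapOfInjective _ ?_ _)).symm
  intro x y h
  have := (Ideal.Quotient.mk_eq_mk_iff_sub_mem x y).1 h
  exact sub_eq_zero.1 (Ideal.mem_bot.1 this)

theorem hilbertFunction_eq_zero {I : Ideal R} {ν : ι → ℕ} (h : ∀ x ∈ 𝒜 ν, x ∈ I) :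
    hilbertFunction 𝒜 I ν = 0 := by
  have : (𝒜 ν).map (Ideal.Quotient.mkₐ k I).toLinearMap = ⊥ := by
    rw [eq_bot_iff, Submodule.map_le_iff_le_comap]
    exact fun x hx => (Submodule.mem_bot k).2 (Ideal.Quotient.eq_zero_iff_mem.2 (h x hx))
  rw [hilbertFunction, this, finrank_bot]

theorem hilbertFunction_anti {I I' : Ideal R} (h : I ≤ I') (ν : ι → ℕ) [Module.Finite k (𝒜 ν)] :
    hilbertFunction 𝒜 I' ν ≤ hilbertFunction 𝒜 I ν := by
  have : (𝒜 ν).map (Ideal.Quotient.mkₐ k I').toLinearMap =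
      ((𝒜 ν).map (Ideal.Quotient.mkₐ k I).toLinearMap).map
        (Ideal.Quotient.factorₐ k h).toLinearMap := by
    rw [← Submodule.map_comp]
    rfl
  rw [hilbertFunction, this]
  exact Submodule.finrank_map_le _ _

theorem one_le_hilbertFunction {I : Ideal R} {ν : ι → ℕ} [Module.Finite k (𝒜 ν)] {x : R}
    (hx : x ∈ 𝒜 ν) (hxI : x ∉ I) : 1 ≤ hilbertFunction 𝒜 I ν := by
  rw [hilbertFunction, Submodule.one_le_finrank_iff]
  intro h
  have : (Ideal.Quotient.mkₐ k I).toLinearMap x ∈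
      (𝒜 ν).map (Ideal.Quotient.mkₐ k I).toLinearMap := Submodule.mem_map_of_mem hx
  rw [h] at this
  exact hxI (Ideal.Quotient.eq_zero_iff_mem.1 ((Submodule.mem_bot k).1 this))

variable {𝒜} in
theorem IsStandard.isNoetherianRing [DecidableEq ι] (hR : IsStandard 𝒜) : IsNoetherianRing R := by
  obtain ⟨s, -, hgen⟩ := hR.generated
  have : Algebra.FiniteType k R := ⟨⟨s, hgen⟩⟩
  exact Algebra.FiniteType.isNoetherianRing k R

variable [Fintype ι] [GradedAlgebra 𝒜]

variable {𝒜} in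
theorem isHomogeneous_colon {I : Ideal R} (hI : I.IsHomogeneous 𝒜) {a : R} {c : ι → ℕ}
    (ha : a ∈ 𝒜 c) : (I.colon {a}).IsHomogeneous 𝒜 := by
  intro ν x hx
  rw [Submodule.mem_colon_singleton, smul_eq_mul] at hx ⊢
  rw [← DirectSum.coe_decompose_mul_add_of_right_mem 𝒜 ha]
  exact hI _ hx

variable {𝒜} in
theorem isHomogeneous_sup_span {I : Ideal R} (hI : I.IsHomogeneous 𝒜) {a : R} {c : ι → ℕ}
    (ha : a ∈ 𝒜 c) : (I ⊔ Ideal.span {a}).IsHomogeneous 𝒜 :=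
  hI.sup (Ideal.homogeneous_span 𝒜 _ fun x hx => ⟨c, by rwa [Set.mem_singleton_iff.1 hx]⟩)

variable {𝒜} in
/-- Dimension count for the exact sequence
`0 → (R ⧸ (I : a))(-c) → R ⧸ I → R ⧸ (I + (a)) → 0`, with `a` of degree `c`. -/
theorem hilbertFunction_add {I : Ideal R} (hI : I.IsHomogeneous 𝒜) {a : R} {c : ι → ℕ}
    (ha : a ∈ 𝒜 c) (ν : ι → ℕ) [Module.Finite k (𝒜 (ν + c))] :
    hilbertFunction 𝒜 I (ν + c) =
      hilbertFunction 𝒜 (I.colon {a}) ν + hilbertFunction 𝒜 (I ⊔ Ideal.span {a}) (ν + c) := by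
  set V := (𝒜 (ν + c)).map (Ideal.Quotient.mkₐ k I).toLinearMap with hV
  have hle : I ≤ I ⊔ Ideal.span {a} := le_sup_left
  let ψ : V →ₗ[k] R ⧸ (I ⊔ Ideal.span {a}) := (Ideal.Quotient.factorₐ k hle).toLinearMap.domRestrict V
  -- Multiplication by `a`, as a map `R ⧸ (I : a) → R ⧸ I`.
  let φ : (R ⧸ I.colon {a}) →ₗ[k] R ⧸ I :=
    (Submodule.mapQ (I.colon {a}) I (LinearMap.mulRight R a) fun x hx => by
      rw [Submodule.mem_colon_singleton] at hx
      exact hx).restrictScalars k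
  have hφ : Function.Injective φ := by
    rw [injective_iff_map_eq_zero]
    intro x hx
    obtain ⟨x, rfl⟩ := Ideal.Quotient.mk_surjective x
    refine Ideal.Quotient.eq_zero_iff_mem.2 ?_
    rw [Submodule.mem_colon_singleton]
    exact Ideal.Quotient.eq_zero_iff_mem.1 hx
  have hrange : LinearMap.range ψ = (𝒜 (ν + c)).map
      (Ideal.Quotient.mkₐ k (I ⊔ Ideal.span {a})).toLinearMap := by
    rw [LinearMap.range_domRestrict, hV, ← Submodule.map_comp]
    rfl
  have hker : (LinearMap.ker ψ).map V.subtype =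
      ((𝒜 ν).map (Ideal.Quotient.mkₐ k (I.colon {a})).toLinearMap).map φ := by
    ext y
    constructor
    · rintro ⟨⟨_, y, hy, rfl⟩, hy0, rfl⟩
      have hy1 : y ∈ I ⊔ Ideal.span {a} := Ideal.Quotient.eq_zero_iff_mem.1 hy0
      obtain ⟨z, hz, w, hw, hzw⟩ := Submodule.mem_sup.1 hy1
      obtain ⟨r, rfl⟩ := Ideal.mem_span_singleton'.1 hw
      -- Taking components of degree `ν + c`, the coefficient `r` may be taken of degree `ν`.
      refine ⟨_, ⟨(DirectSum.decompose 𝒜 r ν : R), SetLike.coe_mem _, rfl⟩, ?_⟩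
      refine (Ideal.Quotient.mk_eq_mk_iff_sub_mem _ _).2 ?_
      change (DirectSum.decompose 𝒜 r ν : R) * a - y ∈ I
      have h1 : y = (DirectSum.decompose 𝒜 z (ν + c) : R) + (DirectSum.decompose 𝒜 r ν : R) * a := by
        rw [← DirectSum.coe_decompose_mul_add_of_right_mem 𝒜 ha, ← Submodule.coe_add,
          ← DirectSum.add_apply, ← DirectSum.decompose_add, hzw, DirectSum.decompose_of_mem_same 𝒜 hy]
      have h2 := hI (ν + c) hz
      rw [h1]
      simpa using h2
    · rintro ⟨_, ⟨x, hx, rfl⟩, rfl⟩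
      have hxa : x * a ∈ 𝒜 (ν + c) := SetLike.mul_mem_graded hx ha
      refine ⟨⟨Ideal.Quotient.mk I (x * a), ⟨x * a, hxa, rfl⟩⟩, ?_, rfl⟩
      refine Ideal.Quotient.eq_zero_iff_mem.2 ?_
      exact Ideal.mem_sup_right (Ideal.mul_mem_left _ _ (Ideal.mem_span_singleton_self a))
  have h := LinearMap.finrank_range_add_finrank_ker ψ
  have h1 : Module.finrank k (LinearMap.ker ψ) =
      Module.finrank k ((LinearMap.ker ψ).map V.subtype) :=
    LinearEquiv.finrank_eq (Submodule.equivMapOfInjective _ V.injective_subtype _)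
  have h2 : hilbertFunction 𝒜 (I.colon {a}) ν = Module.finrank k
      (((𝒜 ν).map (Ideal.Quotient.mkₐ k (I.colon {a})).toLinearMap).map φ) :=
    LinearEquiv.finrank_eq (Submodule.equivMapOfInjective _ hφ _)
  rw [hrange, h1, hker, ← h2, add_comm] at h
  exact h.symm

variable {𝒜} [DecidableEq ι]

theorem IsStandard.finite (hR : IsStandard 𝒜) (ν : ι → ℕ) : Module.Finite k (𝒜 ν) := by
  obtain ⟨s, hs, hgen⟩ := hR.generated
  set V := Submodule.span k (s : Set R) with hV
  have key : ∀ x : R, ∀ ν, (DirectSum.decompose 𝒜 x ν : R) ∈ V ^ (∑ i, ν i) := by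
    intro x
    have hx : x ∈ Algebra.adjoin k (s : Set R) := hgen ▸ Algebra.mem_top
    induction hx using Algebra.adjoin_induction with
    | mem x hx =>
      intro ν
      obtain ⟨i, hi⟩ := hs x hx
      by_cases h : Pi.single i 1 = ν
      · subst h
        rw [DirectSum.decompose_of_mem_same 𝒜 hi]
        simpa using Submodule.subset_span hx
      · rw [DirectSum.decompose_of_mem_ne 𝒜 hi h]
        exact zero_mem _
    | algebraMap r =>
      intro ν
      have hr : algebraMap k R r ∈ 𝒜 0 := SetLike.algebraMap_mem_graded 𝒜 r
      by_cases h : 0 = ν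
      · subst h
        rw [DirectSum.decompose_of_mem_same 𝒜 hr]
        simp
      · rw [DirectSum.decompose_of_mem_ne 𝒜 hr h]
        exact zero_mem _
    | add x y _ _ hx hy =>
      intro ν
      rw [DirectSum.decompose_add, DirectSum.add_apply, Submodule.coe_add]
      exact add_mem (hx ν) (hy ν)
    | mul x y _ _ hx hy =>
      intro ν
      classical
      rw [DirectSum.decompose_mul, DirectSum.coe_mul_apply]
      refine Submodule.sum_mem _ fun ij hij => ?_
      obtain rfl : ij.1 + ij.2 = ν := (Finset.mem_filter.1 hij).2
      simp only [Pi.add_apply, Finset.sum_add_distrib, pow_add]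
      exact Submodule.mul_mem_mul (hx _) (hy _)
  have hle : 𝒜 ν ≤ V ^ (∑ i, ν i) := fun x hx => by
    have := key x ν
    rwa [DirectSum.decompose_of_mem_same 𝒜 hx] at this
  have hfg : (V ^ (∑ i, ν i)).FG := (Submodule.fg_span s.finite_toSet).pow _
  have : Module.Finite k ↥(V ^ (∑ i, ν i)) := Module.Finite.iff_fg.2 hfg
  exact Submodule.finiteDimensional_of_le hle

theorem IsStandard.mem_partIdeal (hR : IsStandard 𝒜) {ν : ι → ℕ} {i : ι} (hi : 1 ≤ ν i) {x : R}
    (hx : x ∈ 𝒜 ν) : x ∈ partIdeal 𝒜 i := by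
  obtain ⟨s, hs, hgen⟩ := hR.generated
  have key : ∀ x : R, ∀ ν, 1 ≤ ν i → (DirectSum.decompose 𝒜 x ν : R) ∈ partIdeal 𝒜 i := by
    intro x
    have hx : x ∈ Algebra.adjoin k (s : Set R) := hgen ▸ Algebra.mem_top
    induction hx using Algebra.adjoin_induction with
    | mem x hx =>
      intro ν hν
      obtain ⟨j, hj⟩ := hs x hx
      by_cases h : Pi.single j 1 = ν
      · subst h
        rw [DirectSum.decompose_of_mem_same 𝒜 hj]
        have hji : j = i := by
          by_contra hji
          simp [Ne.symm hji] at hν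
        subst hji
        exact Ideal.subset_span hj
      · rw [DirectSum.decompose_of_mem_ne 𝒜 hj h]
        exact zero_mem _
    | algebraMap r =>
      intro ν hν
      have hr : algebraMap k R r ∈ 𝒜 0 := SetLike.algebraMap_mem_graded 𝒜 r
      have h : 0 ≠ ν := by rintro rfl; simp at hν
      rw [DirectSum.decompose_of_mem_ne 𝒜 hr h]
      exact zero_mem _
    | add x y _ _ hx hy =>
      intro ν hν
      rw [DirectSum.decompose_add, DirectSum.add_apply, Submodule.coe_add]
      exact add_mem (hx ν hν) (hy ν hν)
    | mul x y _ _ hx hy =>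
      intro ν hν
      classical
      rw [DirectSum.decompose_mul, DirectSum.coe_mul_apply]
      refine Ideal.sum_mem _ fun ij hij => ?_
      obtain rfl : ij.1 + ij.2 = ν := (Finset.mem_filter.1 hij).2
      rcases Nat.eq_zero_or_pos (ij.1 i) with h0 | h0
      · refine Ideal.mul_mem_left _ _ (hy _ ?_)
        simpa [h0] using hν
      · exact Ideal.mul_mem_right _ _ (hx _ h0)
  have := key x ν hi
  rwa [DirectSum.decompose_of_mem_same 𝒜 hx] at this

theorem le_colon_singleton (I : Ideal R) (x : R) : I ≤ I.colon {x} := fun r hr => by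
  rw [Submodule.mem_colon_singleton]
  exact I.mul_mem_right x hr

theorem lt_sup_span_singleton {I : Ideal R} {x : R} (hx : x ∉ I) : I < I ⊔ Ideal.span {x} :=
  left_lt_sup.2 fun h => hx (h (Ideal.mem_span_singleton_self x))

/-- Every homogeneous ideal `I` has a Hilbert polynomial, by Noetherian induction. Either some `x` of
degree some `e_i` outside `I` is a zero divisor modulo `I`, and then both `I : x` and `I + (x)` are
larger than `I`; or some `[R]_{e_i}` lies in `I`, and the Hilbert function vanishes in large
degrees; or all its partial differences are Hilbert functions of larger ideals. -/
theorem IsStandard.exists_hilbertPolynomial (hR : IsStandard 𝒜) (I : Ideal R)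
    (hI : I.IsHomogeneous 𝒜) :
    ∃ P, EventuallyEval (fun ν => (hilbertFunction 𝒜 I ν : ℚ)) P := by
  have := hR.finite
  have := hR.isNoetherianRing
  induction I using WellFoundedGT.induction with
  | ind I ih =>
  by_cases h : ∃ i, ∃ x ∈ 𝒜 (Pi.single i 1), x ∉ I ∧ I.colon {x} ≠ I
  · obtain ⟨i, x, hx, hxI, hne⟩ := h
    obtain ⟨P, hP⟩ := ih _ ((le_colon_singleton I x).lt_of_ne' hne) (isHomogeneous_colon hI hx)
    obtain ⟨Q, hQ⟩ := ih _ (lt_sup_span_singleton hxI) (isHomogeneous_sup_span hI hx)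
    refine exists_eventuallyEval_of_add_right (Pi.single i 1)
      (P := P + translate (Pi.single i 1) Q) ?_
    convert hP.add (hQ.translate (Pi.single i 1)) using 1
    funext ν
    rw [hilbertFunction_add hI hx]
    push_cast
    rfl
  · push Not at h
    by_cases h0 : ∃ i, ∀ x ∈ 𝒜 (Pi.single i 1), x ∈ I
    · obtain ⟨i, hi⟩ := h0
      refine ⟨0, Pi.single i 1, fun ν hν => ?_⟩
      have hνi : 1 ≤ ν i := by simpa using hν i
      rw [map_zero]
      refine (Nat.cast_eq_zero.2 (hilbertFunction_eq_zero 𝒜 fun x hx => ?_)).symm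
      exact Ideal.span_le.2 hi (hR.mem_partIdeal hνi hx)
    · push Not at h0
      refine exists_eventuallyEval_of_difference _ fun i => ?_
      obtain ⟨x, hx, hxI⟩ := h0 i
      obtain ⟨Q, hQ⟩ := ih _ (lt_sup_span_singleton hxI) (isHomogeneous_sup_span hI hx)
      refine ⟨translate (Pi.single i 1) Q, ?_⟩
      convert hQ.translate (Pi.single i 1) using 1
      funext ν
      rw [hilbertFunction_add hI hx, h i x hx hxI]
      push_cast
      ring

end HilbertFunction

/-! ### Chains of relevant primes -/

section Chains

variable {k : Type u} {R : Type v} [Field k] [CommRing R] [Algebra k R]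
variable {ι : Type*} [Fintype ι]

theorem prod_pow_notMem {P : Ideal R} [hP : P.IsPrime] {x : ι → R} (hx : ∀ i, x i ∉ P)
    (a : ι → ℕ) : ∏ i, x i ^ a i ∉ P := by
  rw [hP.prod_mem_iff]
  rintro ⟨i, -, hi⟩
  exact hx i (hP.mem_of_pow_mem _ hi)

variable [DecidableEq ι]

/-- Any instance of decidable equality is allowed on the degrees, not just that of their order. -/
theorem exists_homogeneous_mul_mem_of_linearOrder {κ : Type*} [AddCommMonoid κ] [LinearOrder κ]
    [IsOrderedCancelAddMonoid κ] [inst : DecidableEq κ] {𝒜 : κ → Submodule k R}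
    [gr : GradedAlgebra 𝒜]
    {I : Ideal R} (hI : I.IsHomogeneous 𝒜) (hne : I ≠ ⊤) (hp : ¬ I.IsPrime) :
    ∃ c, ∃ a ∈ 𝒜 c, ∃ b, a ∉ I ∧ b ∉ I ∧ a * b ∈ I := by
  obtain rfl : inst = LinearOrder.toDecidableEq := Subsingleton.elim _ _
  by_contra! hcon
  refine hp (Ideal.IsHomogeneous.isPrime_of_homogeneous_mem_or_mem hI hne ?_)
  rintro x y ⟨c, hx⟩ - hxy
  by_contra! h
  exact hcon c x hx y h.1 h.2 hxy

/-- A prime ideal is relevant iff it contains none of the components `[R]_{e_i}`. -/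
theorem not_irrelevant_le_iff {𝒜 : (ι → ℕ) → Submodule k R} {P : Ideal R} [hP : P.IsPrime] :
    ¬ irrelevant 𝒜 ≤ P ↔ ∀ i, ∃ x ∈ 𝒜 (Pi.single i 1), x ∉ P := by
  constructor
  · intro h i
    by_contra! hi
    exact h ((iInf_le _ i).trans (Ideal.span_le.2 hi))
  · intro h hle
    choose x hx hxP using h
    refine prod_pow_notMem hxP 1 (hle (Ideal.mem_iInf.2 fun i => ?_))
    have hdvd : x i ∣ ∏ i, x i ^ (1 : ι → ℕ) i := by
      simpa using Finset.dvd_prod_of_mem x (Finset.mem_univ i)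
    exact Ideal.mem_of_dvd _ hdvd (Ideal.subset_span (hx i))

theorem extendDeg_restrict {ι : Type*} [DecidableEq ι] {J : Finset ι} {a : ι → ℕ}
    (ha : ∀ i ∉ J, a i = 0) :
    extendDeg J (fun j => a j) = a := by
  funext i
  by_cases hi : i ∈ J <;> simp [extendDeg, hi, ha]

variable {𝒜 : (ι → ℕ) → Submodule k R} [GradedAlgebra 𝒜]

theorem prod_pow_mem {x : ι → R} (hx : ∀ i, x i ∈ 𝒜 (Pi.single i 1)) (a : ι → ℕ) :
    ∏ i, x i ^ a i ∈ 𝒜 a := by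
  have h := SetLike.prod_mem_graded 𝒜 (fun i => a i • (Pi.single i 1 : ι → ℕ)) (fun i => x i ^ a i)
    (F := Finset.univ) fun i _ => SetLike.pow_mem_graded (a i) (hx i)
  have ha : ∑ i, a i • (Pi.single i 1 : ι → ℕ) = a := by
    funext j
    simp [Finset.sum_apply, Pi.single_apply]
  rwa [ha] at h

omit [DecidableEq ι] in
/-- If a homogeneous ideal is not prime, this is witnessed by a product with a homogeneous factor. The
multidegrees are linearly ordered by the lexicographic order. -/
theorem exists_homogeneous_mul_mem [LinearOrder ι] {I : Ideal R} (hI : I.IsHomogeneous 𝒜)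
    (hne : I ≠ ⊤) (hp : ¬ I.IsPrime) :
    ∃ c, ∃ a ∈ 𝒜 c, ∃ b, a ∉ I ∧ b ∉ I ∧ a * b ∈ I :=
  exists_homogeneous_mul_mem_of_linearOrder (κ := Lex (ι → ℕ))
    (inst := (inferInstance : DecidableEq (ι → ℕ))) (𝒜 := 𝒜)
    (gr := (inferInstance : GradedAlgebra 𝒜)) hI hne hp

variable (𝒜) in
/-- The primes of `R_(J)` that are contractions of points of `MultiProj R`. -/
abbrev imagePrimes (J : Finset ι) : Set (PrimeSpectrum (supportedSubalgebra 𝒜 J)) :=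
  Set.range fun P : MultiProj 𝒜 => (projection 𝒜 J P).1

theorem mem_supportedSubalgebra {J : Finset ι} {a : ι → ℕ} (ha : ∀ i ∉ J, a i = 0) {x : R}
    (hx : x ∈ 𝒜 a) : x ∈ supportedSubalgebra 𝒜 J := by
  rw [← extendDeg_restrict ha] at hx
  exact Submodule.mem_iSup_of_mem (p := fun μ : J → ℕ => 𝒜 (extendDeg J μ)) _ hx

theorem colon_singleton_eq_self {I : Ideal R} [hI : I.IsPrime] {x : R} (hx : x ∉ I) :
    I.colon {x} = I :=
  le_antisymm (fun r hr => by
    rw [Submodule.mem_colon_singleton] at hr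
    exact (hI.mem_or_mem hr).resolve_right hx) (le_colon_singleton I x)

theorem translate_hilbertPolynomial (hR : IsStandard 𝒜) {I : Ideal R} (hI : I.IsHomogeneous 𝒜)
    {a : R} {c : ι → ℕ} (ha : a ∈ 𝒜 c) {P P₁ P₂ : MvPolynomial ι ℚ}
    (hP : EventuallyEval (fun ν => (hilbertFunction 𝒜 I ν : ℚ)) P)
    (hP₁ : EventuallyEval (fun ν => (hilbertFunction 𝒜 (I.colon {a}) ν : ℚ)) P₁)
    (hP₂ : EventuallyEval (fun ν => (hilbertFunction 𝒜 (I ⊔ Ideal.span {a}) ν : ℚ)) P₂) :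
    translate c P = P₁ + translate c P₂ := by
  have := hR.finite
  refine (hP.translate c).unique ?_
  convert hP₁.add (hP₂.translate c) using 1
  funext ν
  rw [hilbertFunction_add hI ha]
  push_cast
  rfl

/-- If the Hilbert polynomial of `R ⧸ I` has degree at least `d` in the variables indexed by `J`,
there is a chain of length `d` of contractions to `R_(J)` of relevant primes containing `I`. This is
a Noetherian induction: if `I` is not prime, the degree is attained for `I : a` or `I + (a)`, for some
homogeneous `a`; if it is prime, `I` itself is put below a chain of length `d - 1` for `I + (f)`, with
`f ∈ R_(J) \ I` such that the difference in the direction of its degree lowers the degree by just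
one. -/
theorem exists_ltSeries_of_reachesDegree [LinearOrder ι] (hR : IsStandard 𝒜) (J : Finset ι)
    (I : Ideal R) (hI : I.IsHomogeneous 𝒜) (P : MvPolynomial ι ℚ)
    (hP : EventuallyEval (fun ν => (hilbertFunction 𝒜 I ν : ℚ)) P) (d : ℕ)
    (hd : ReachesDegree J d P) :
    ∃ q : LTSeries (imagePrimes 𝒜 J), q.length = d ∧
      I.comap (supportedSubalgebra 𝒜 J).val ≤ (q.head : PrimeSpectrum _).asIdeal := by
  have := hR.finite
  have := hR.isNoetherianRing
  induction I using WellFoundedGT.induction generalizing P d with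
  | ind I ih =>
  have hne : I ≠ ⊤ := by
    rintro rfl
    refine hd.ne_zero (hP.unique ⟨0, fun ν _ => ?_⟩)
    rw [map_zero]
    exact (Nat.cast_eq_zero.2 (hilbertFunction_eq_zero 𝒜 fun x _ => Submodule.mem_top)).symm
  by_cases hprime : I.IsPrime
  · have hrel : ∀ i, ∃ x ∈ 𝒜 (Pi.single i 1), x ∉ I := by
      by_contra! h
      obtain ⟨i, hi⟩ := h
      refine hd.ne_zero (hP.unique ⟨Pi.single i 1, fun ν hν => ?_⟩)
      have hνi : 1 ≤ ν i := by simpa using hν i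
      rw [map_zero]
      refine (Nat.cast_eq_zero.2 (hilbertFunction_eq_zero 𝒜 fun x hx => ?_)).symm
      exact Ideal.span_le.2 hi (hR.mem_partIdeal hνi hx)
    let Pt : MultiProj 𝒜 := ⟨⟨I, hprime⟩, hI, not_irrelevant_le_iff.2 hrel⟩
    cases d with
    | zero => exact ⟨RelSeries.singleton _ ⟨_, Pt, rfl⟩, rfl, le_rfl⟩
    | succ d =>
      obtain ⟨a, ha, had⟩ := hd.exists_difference
      choose x hx hxI using id hrel
      set f := ∏ i, x i ^ a i with hf
      have hfa : f ∈ 𝒜 a := prod_pow_mem hx a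
      have hfI : f ∉ I := prod_pow_notMem hxI a
      have hI' := isHomogeneous_sup_span hI hfa
      obtain ⟨P₂, hP₂⟩ := hR.exists_hilbertPolynomial _ hI'
      have hPP := translate_hilbertPolynomial hR hI hfa hP (P₁ := P)
        (by rwa [colon_singleton_eq_self hfI]) hP₂
      rw [hPP, add_sub_cancel_left, reachesDegree_translate_iff] at had
      obtain ⟨q, hq, hqI⟩ := ih _ (lt_sup_span_singleton hfI) hI' P₂ hP₂ d had
      have hlt : (⟨_, Pt, rfl⟩ : imagePrimes 𝒜 J) < q.head := by
        refine Subtype.coe_lt_coe.1 (lt_of_le_not_ge (α := PrimeSpectrum _) ?_ ?_)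
        · exact (Ideal.comap_mono le_sup_left).trans hqI
        · intro hle
          have hfS : (⟨f, mem_supportedSubalgebra ha hfa⟩ : supportedSubalgebra 𝒜 J) ∈
              (q.head : PrimeSpectrum _).asIdeal :=
            hqI (Ideal.mem_comap.2 (Ideal.mem_sup_right (Ideal.mem_span_singleton_self f)))
          exact hfI (hle hfS)
      exact ⟨q.cons _ hlt, by simp [hq], le_rfl⟩
  · obtain ⟨c, a, ha, b, haI, hbI, hab⟩ := exists_homogeneous_mul_mem hI hne hprime
    have hlt : I < I.colon {a} := (le_colon_singleton I a).lt_of_not_ge fun h =>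
      hbI (h (by rwa [Submodule.mem_colon_singleton, smul_eq_mul, mul_comm]))
    have hI₁ := isHomogeneous_colon hI ha
    have hI₂ := isHomogeneous_sup_span hI ha
    obtain ⟨P₁, hP₁⟩ := hR.exists_hilbertPolynomial _ hI₁
    obtain ⟨P₂, hP₂⟩ := hR.exists_hilbertPolynomial _ hI₂
    rw [← reachesDegree_translate_iff (c := c),
      translate_hilbertPolynomial hR hI ha hP hP₁ hP₂] at hd
    rcases hd.or_of_add with h | h
    · obtain ⟨q, hq, hqI⟩ := ih _ hlt hI₁ P₁ hP₁ d h
      exact ⟨q, hq, (Ideal.comap_mono hlt.le).trans hqI⟩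
    · obtain ⟨q, hq, hqI⟩ := ih _ (lt_sup_span_singleton haI) hI₂ P₂ hP₂ d
        (reachesDegree_translate_iff.1 h)
      exact ⟨q, hq, (Ideal.comap_mono le_sup_left).trans hqI⟩

/-- Along the diagonal, the Hilbert function of `R ⧸ P_0` dominates a binomial coefficient with lower
index the length of a chain `P_0 < ⋯ < P_n` of relevant primes. Dividing `R ⧸ P_0` by an element of
`P_1` of degree `(M, …, M)` gives `H_{P_0}(s + 1) ≥ H_{P_0}(s) + H_{P_1}(s + 1)`, where `s` stands
for the multidegree `(s M, …, s M)`. -/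
theorem choose_le_hilbertFunction [∀ ν, Module.Finite k (𝒜 ν)] (n : ℕ) (P : ℕ → PrimeSpectrum R)
    (hP : ∀ i ≤ n, (P i).asIdeal.IsHomogeneous 𝒜 ∧ ¬ irrelevant 𝒜 ≤ (P i).asIdeal)
    (hlt : ∀ i < n, P i < P (i + 1)) :
    ∃ M₀ : ℕ, ∀ M ≥ M₀, ∀ s : ℕ,
      s.choose n ≤ hilbertFunction 𝒜 (P 0).asIdeal (fun _ => s * M) := by
  induction n generalizing P with
  | zero =>
    refine ⟨0, fun M _ s => ?_⟩
    choose x hx hxP using not_irrelevant_le_iff.1 (hP 0 le_rfl).2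
    rw [Nat.choose_zero_right]
    exact one_le_hilbertFunction 𝒜 (prod_pow_mem hx _) (prod_pow_notMem hxP _)
  | succ n ih =>
    obtain ⟨M₀, hM₀⟩ := ih (fun i => P (i + 1)) (fun i hi => hP (i + 1) (by omega))
      (fun i hi => hlt (i + 1) (by omega))
    obtain ⟨hhom, hrel⟩ := hP 0 (by omega)
    choose x hx hxP using not_irrelevant_le_iff.1 hrel
    obtain ⟨c, f, hf, hf1, hf0⟩ : ∃ c, ∃ f ∈ 𝒜 c, f ∈ (P 1).asIdeal ∧ f ∉ (P 0).asIdeal := by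
      have h01 := hlt 0 (by omega)
      obtain ⟨f, hf1, hf0⟩ := SetLike.not_le_iff_exists.1
        ((PrimeSpectrum.asIdeal_lt_asIdeal _ _).2 h01).not_ge
      obtain ⟨c, hc⟩ := not_forall.1 (mt (hhom.mem_iff 𝒜).2 hf0)
      exact ⟨c, _, SetLike.coe_mem _, (hP 1 (by omega)).1 c hf1, hc⟩
    refine ⟨max M₀ (Finset.univ.sup c), fun M hM => ?_⟩
    have hcM : ∀ i, c i ≤ M := fun i =>
      (Finset.le_sup (Finset.mem_univ i)).trans ((le_max_right _ _).trans hM)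
    set g := f * ∏ i, x i ^ (M - c i) with hg
    have hgM : g ∈ 𝒜 (fun _ => M) := by
      have h := SetLike.mul_mem_graded hf (prod_pow_mem hx fun i => M - c i)
      have hc : c + (fun i => M - c i) = fun _ => M :=
        funext fun i => Nat.add_sub_cancel' (hcM i)
      rwa [hc] at h
    have hg1 : g ∈ (P 1).asIdeal := Ideal.mul_mem_right _ _ hf1
    have hg0 : g ∉ (P 0).asIdeal := fun h =>
      ((P 0).2.mem_or_mem h).elim hf0 (prod_pow_notMem hxP _)
    intro s
    induction s with
    | zero => simp
    | succ s ihs =>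
      have h1 : (fun _ : ι => (s + 1) * M) = (fun _ => s * M) + fun _ => M :=
        funext fun _ => Nat.succ_mul s M
      have h2 := hilbertFunction_add hhom hgM (fun _ => s * M)
      have h3 := hilbertFunction_anti 𝒜 (sup_le (hlt 0 (by omega)).le
        ((Ideal.span_singleton_le_iff_mem _).2 hg1)) ((fun _ => s * M) + fun _ => M)
      have h4 := hM₀ M ((le_max_left _ _).trans hM) (s + 1)
      have h5 := Nat.choose_le_choose n (Nat.le_succ s)
      rw [colon_singleton_eq_self hg0] at h2
      rw [h1] at h4 ⊢
      rw [Nat.choose_succ_succ, h2]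
      exact (Nat.add_comm _ _).trans_le (add_le_add ihs (h5.trans (h4.trans h3)))

theorem finite_subgrading [∀ ν, Module.Finite k (𝒜 ν)] (J : Finset ι) (μ : J → ℕ) :
    Module.Finite k (subgrading 𝒜 J μ) :=
  Module.Finite.of_injective
    ((supportedSubalgebra 𝒜 J).val.toLinearMap.restrict
      (p := subgrading 𝒜 J μ) (q := 𝒜 (extendDeg J μ)) fun _ hx => hx)
    fun _ _ h => Subtype.ext (Subtype.ext congr(($h : R)))

theorem hilbertFunction_subgrading (J : Finset ι) (I : Ideal R) (μ : J → ℕ) :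
    hilbertFunction (subgrading 𝒜 J) (I.comap (supportedSubalgebra 𝒜 J).val) μ =
      hilbertFunction 𝒜 I (extendDeg J μ) := by
  let φ : (supportedSubalgebra 𝒜 J ⧸ I.comap (supportedSubalgebra 𝒜 J).val) →ₐ[k] R ⧸ I :=
    Ideal.quotientMapₐ I (supportedSubalgebra 𝒜 J).val le_rfl
  have hφ : Function.Injective φ := Ideal.quotientMap_injective
  rw [hilbertFunction, hilbertFunction, ← map_subgrading 𝒜 J μ,
    LinearEquiv.finrank_eq (Submodule.equivMapOfInjective φ.toLinearMap hφ _),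
    ← Submodule.map_comp, ← Submodule.map_comp]
  rfl

/-- The length of a chain of contracted primes is at most the degree of the Hilbert polynomial in
the variables indexed by `J`: on a line in the diagonal direction of these variables, the Hilbert
function of `R` dominates that of `R_(J) ⧸ Q`, where `Q = P ∩ R_(J)` is the smallest prime in the
chain, since multiplication by a homogeneous element outside `P` is injective modulo `P`. -/
theorem reachesDegree_of_ltSeries (hR : IsStandard 𝒜) (J : Finset ι) {P : MvPolynomial ι ℚ}
    (hP : IsHilbertPolynomial 𝒜 P) (q : LTSeries (imagePrimes 𝒜 J)) :
    ReachesDegree J q.length P := by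
  have := hR.finite
  have := finite_subgrading (𝒜 := 𝒜) J
  obtain ⟨w, hw⟩ := hP
  obtain ⟨M₀, hM₀⟩ := choose_le_hilbertFunction (𝒜 := subgrading 𝒜 J) q.length
    (fun i => (q (Fin.ofNat (q.length + 1) i)).1)
    (fun i _ => by
      obtain ⟨p, hp⟩ := (q (Fin.ofNat (q.length + 1) i)).2
      rw [← hp]
      exact (projection 𝒜 J p).2)
    (fun i hi => Subtype.coe_lt_coe.2 (q.strictMono (by
      rw [Fin.lt_def, Fin.val_ofNat, Fin.val_ofNat, Nat.mod_eq_of_lt (by omega),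
        Nat.mod_eq_of_lt (by omega)]
      omega)))
  obtain ⟨p, hp⟩ := (q (Fin.ofNat (q.length + 1) 0)).2
  choose x hx hxp using not_irrelevant_le_iff.1 p.2.2
  set M := max M₀ (Finset.univ.sup w) with hM
  have hwM : ∀ i, w i ≤ M := fun i =>
    (Finset.le_sup (Finset.mem_univ i)).trans (le_max_right _ _)
  let b : ι → ℕ := fun i => if i ∈ J then 0 else w i
  refine ⟨fun i => if i ∈ J then M else 0, fun i => (b i : ℚ), fun i hi => if_neg hi,
    le_degree_of_choose_le fun s hs => ?_⟩
  set ν : ι → ℕ := extendDeg J (fun _ => s * M) + b with hν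
  have hwν : w ≤ ν := by
    intro i
    by_cases hi : i ∈ J
    · simpa [hν, b, hi, extendDeg] using (hwM i).trans (Nat.le_mul_of_pos_left M hs)
    · simp [hν, b, hi, extendDeg]
  have hev : (line (fun i => if i ∈ J then M else 0) (fun i => (b i : ℚ)) P).eval (s : ℚ) =
      Module.finrank k (𝒜 ν) := by
    rw [eval_line, ← hw ν hwν]
    congr 2
    funext i
    by_cases hi : i ∈ J <;> simp [hν, b, hi, extendDeg, mul_comm]
  rw [hev, Nat.cast_le]
  calc s.choose q.length
      ≤ hilbertFunction (subgrading 𝒜 J) (q (Fin.ofNat (q.length + 1) 0)).1.asIdeal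
          (fun _ => s * M) := hM₀ M (le_max_left _ _) s
    _ = hilbertFunction 𝒜 p.1.asIdeal (extendDeg J fun _ => s * M) := by
        rw [← hp]
        exact hilbertFunction_subgrading J p.1.asIdeal _
    _ ≤ hilbertFunction 𝒜 p.1.asIdeal ν := by
        have h := hilbertFunction_add p.2.1 (prod_pow_mem hx b) (extendDeg J fun _ => s * M)
        rw [colon_singleton_eq_self (prod_pow_notMem hxp b)] at h
        rw [hν, h]
        exact Nat.le_add_right _ _
    _ ≤ hilbertFunction 𝒜 (⊥ : Ideal R) ν := hilbertFunction_anti 𝒜 bot_le ν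
    _ = Module.finrank k (𝒜 ν) := hilbertFunction_bot 𝒜 ν

end Chains

/-! ### Sobriety and the Krull dimension of the image -/

section Topology

open TopologicalSpace Topology

/-- A continuous image of a Noetherian sober space is sober: for a closed irreducible subset `Z` of the
image, one of the finitely many irreducible components of its preimage dominates `Z`, and the
image of the generic point of this component is generic in `Z`. -/
theorem quasiSober_of_surjective {X Y : Type*} [TopologicalSpace X] [TopologicalSpace Y]
    [QuasiSober X] [NoetherianSpace X] {f : X → Y} (hf : Continuous f)
    (hsurj : Function.Surjective f) : QuasiSober Y where
  sober {Z} hZ hZc := by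
    obtain ⟨S, hSfin, hSc, hSirr, hS⟩ :=
      NoetherianSpace.exists_finite_set_isClosed_irreducible (hZc.preimage hf)
    obtain ⟨_, hz, hZz⟩ := isIrreducible_iff_sUnion_isClosed.1 hZ
      (hSfin.image fun t => closure (f '' t)).toFinset
      (by
        intro z hz
        obtain ⟨t, -, rfl⟩ := (Set.Finite.mem_toFinset _).1 hz
        exact isClosed_closure)
      (by
        intro y hy
        obtain ⟨x, rfl⟩ := hsurj y
        have hx : x ∈ ⋃₀ S := hS ▸ hy
        obtain ⟨t, ht, hxt⟩ := hx
        exact ⟨_, (Set.Finite.mem_toFinset _).2 ⟨t, ht, rfl⟩,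
          subset_closure (Set.mem_image_of_mem f hxt)⟩)
    obtain ⟨t, ht, rfl⟩ := (Set.Finite.mem_toFinset _).1 hz
    obtain ⟨x, hx⟩ := QuasiSober.sober (hSirr t ht) (hSc t ht)
    refine ⟨f x, Set.Subset.antisymm ?_ (hZz.trans ?_)⟩
    · refine closure_minimal (Set.singleton_subset_iff.2 ?_) hZc
      have : x ∈ f ⁻¹' Z := hS ▸ ⟨t, ht, hx.mem⟩
      exact this
    · rw [← hx.def]
      refine closure_minimal ?_ isClosed_closure
      rw [← Set.image_singleton]
      exact image_closure_subset_closure_image hf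

/-- The dimension of a sober space of primes is the length of its chains of primes. -/
theorem topologicalKrullDim_eq_krullDim_range {Y A : Type*} [TopologicalSpace Y] [QuasiSober Y]
    [CommRing A] {e : Y → PrimeSpectrum A} (he : IsEmbedding e) :
    topologicalKrullDim Y = Order.krullDim (Set.range e) := by
  have : T0Space Y := he.t0Space
  let φ : IrreducibleCloseds Y ≃o (Set.range e)ᵒᵈ :=
    { toEquiv := (irreducibleSetEquivPoints.toEquiv.trans
        (Equiv.ofInjective e he.injective)).trans OrderDual.toDual
      map_rel_iff' := by
        intro s t
        refine Iff.trans ?_ irreducibleSetEquivPoints.map_rel_iff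
        refine (PrimeSpectrum.le_iff_specializes _ _).trans ?_
        exact he.isInducing.specializes_iff }
  rw [topologicalKrullDim, Order.krullDim_eq_of_orderIso φ, Order.krullDim_orderDual]

variable {k : Type u} {R : Type v} [Field k] [CommRing R] [Algebra k R]
variable {ι : Type*} [Fintype ι] [DecidableEq ι]
variable (𝒜 : (ι → ℕ) → Submodule k R) [GradedAlgebra 𝒜]

/-- A closed irreducible set of relevant homogeneous primes has the intersection of its members as
generic point. -/
theorem quasiSober_multiProj : QuasiSober (MultiProj 𝒜) where
  sober {Z} hZ hZc := by
    set T : Set (PrimeSpectrum R) := Subtype.val '' Z with hT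
    have hTirr : IsIrreducible T := hZ.image _ continuous_subtype_val.continuousOn
    have hprime := PrimeSpectrum.isIrreducible_iff_vanishingIdeal_isPrime.1 hTirr
    set I := PrimeSpectrum.vanishingIdeal T with hIdef
    have hhom : I.IsHomogeneous 𝒜 := by
      intro c x hx
      rw [PrimeSpectrum.mem_vanishingIdeal] at hx ⊢
      rintro _ ⟨p, hp, rfl⟩
      exact p.2.1 c (hx _ ⟨p, hp, rfl⟩)
    have hrel : ¬ irrelevant 𝒜 ≤ I := by
      obtain ⟨p, hp⟩ := hZ.nonempty
      intro h
      exact p.2.2 (h.trans fun x hx => (PrimeSpectrum.mem_vanishingIdeal _ _).1 hx _ ⟨p, hp, rfl⟩)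
    have hcl : closure {(⟨I, hprime⟩ : PrimeSpectrum R)} = closure T := by
      rw [PrimeSpectrum.closure_singleton, ← PrimeSpectrum.zeroLocus_vanishingIdeal_eq_closure]
    refine ⟨⟨⟨I, hprime⟩, hhom, hrel⟩, ?_⟩
    have hind : IsInducing (Subtype.val : MultiProj 𝒜 → PrimeSpectrum R) := IsInducing.subtypeVal
    rw [IsGenericPoint, ← hZc.closure_eq, hind.closure_eq_preimage_closure_image,
      hind.closure_eq_preimage_closure_image, Set.image_singleton, hcl]

theorem continuous_projection (J : Finset ι) : Continuous (projection 𝒜 J) :=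
  ((PrimeSpectrum.continuous_comap _).comp continuous_subtype_val).subtype_mk _

variable {𝒜} in
theorem topologicalKrullDim_range_projection (hR : IsStandard 𝒜) (J : Finset ι) :
    topologicalKrullDim (Set.range (projection 𝒜 J)) = Order.krullDim (imagePrimes 𝒜 J) := by
  have := hR.isNoetherianRing
  have := quasiSober_multiProj 𝒜
  have : NoetherianSpace (MultiProj 𝒜) := IsInducing.subtypeVal.noetherianSpace
  have : QuasiSober (Set.range (projection 𝒜 J)) :=
    quasiSober_of_surjective (continuous_projection 𝒜 J).rangeFactorization
      Set.rangeFactorization_surjective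
  rw [topologicalKrullDim_eq_krullDim_range (IsEmbedding.subtypeVal.comp IsEmbedding.subtypeVal)]
  have : Set.range (Subtype.val ∘ Subtype.val : Set.range (projection 𝒜 J) → _) =
      imagePrimes 𝒜 J := by
    rw [Set.range_comp, Subtype.range_val, ← Set.range_comp]
    rfl
  rw [this]

end Topology

/-! ### The Hilbert polynomial and the dimension of the image -/

section HilbertPolynomial

variable {k : Type u} {R : Type v} [Field k] [CommRing R] [Algebra k R]
variable {ι : Type*} [Fintype ι] [DecidableEq ι]
variable {𝒜 : (ι → ℕ) → Submodule k R} [GradedAlgebra 𝒜]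

omit [Fintype ι] [DecidableEq ι] [GradedAlgebra 𝒜] in
theorem isHilbertPolynomial_iff {P : MvPolynomial ι ℚ} :
    IsHilbertPolynomial 𝒜 P ↔
      EventuallyEval (fun ν => (hilbertFunction 𝒜 (⊥ : Ideal R) ν : ℚ)) P := by
  simp only [IsHilbertPolynomial, EventuallyEval, hilbertFunction_bot]

theorem IsStandard.existsUnique_isHilbertPolynomial (hR : IsStandard 𝒜) :
    ∃! P : MvPolynomial ι ℚ, IsHilbertPolynomial 𝒜 P := by
  simp only [isHilbertPolynomial_iff]
  obtain ⟨P, hP⟩ := hR.exists_hilbertPolynomial ⊥ (Ideal.IsHomogeneous.bot 𝒜)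
  exact ⟨P, hP, fun Q hQ => EventuallyEval.unique hQ hP⟩

theorem IsStandard.topologicalKrullDim_range_projection_eq_degreeIn [LinearOrder ι]
    (hR : IsStandard 𝒜) (hX : Nonempty (MultiProj 𝒜)) {P : MvPolynomial ι ℚ}
    (hP : IsHilbertPolynomial 𝒜 P) (J : Finset ι) :
    topologicalKrullDim (Set.range (projection 𝒜 J)) = (degreeIn J P : WithBot ℕ∞) := by
  obtain ⟨x⟩ := hX
  -- A point of `MultiProj R` is a chain of length `0`; its existence makes `P` nonzero.
  have hP0 : P ≠ 0 :=
    (reachesDegree_of_ltSeries hR J hP (RelSeries.singleton _ ⟨_, x, rfl⟩)).ne_zero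
  rw [topologicalKrullDim_range_projection hR J]
  refine le_antisymm (iSup_le fun q => ?_) ?_
  · exact_mod_cast (reachesDegree_of_ltSeries hR J hP q).le_degreeIn
  · obtain ⟨q, hq, -⟩ := exists_ltSeries_of_reachesDegree hR J ⊥ (Ideal.IsHomogeneous.bot 𝒜) P
      (isHilbertPolynomial_iff.1 hP) _ (reachesDegree_degreeIn J hP0)
    rw [← hq]
    exact Order.LTSeries.length_le_krullDim q

end HilbertPolynomial
end MultigradedAlgebra

theorem mainTheorem6 {p : ℕ} (hp : 1 ≤ p) {k : Type*} [Field k] {R : Type*} [CommRing R]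
    [Algebra k R] (𝒜 : (Fin p → ℕ) → Submodule k R) [GradedAlgebra 𝒜]
    (hR : MultigradedAlgebra.IsStandard 𝒜) (hX : Nonempty (MultigradedAlgebra.MultiProj 𝒜)) :
    (∃! P : MvPolynomial (Fin p) ℚ, MultigradedAlgebra.IsHilbertPolynomial 𝒜 P) ∧
    ∀ P : MvPolynomial (Fin p) ℚ, MultigradedAlgebra.IsHilbertPolynomial 𝒜 P →
      ∀ J : Finset (Fin p),
        topologicalKrullDim (Set.range (MultigradedAlgebra.projection 𝒜 J)) =
          ((MultigradedAlgebra.degreeIn J P : ℕ) : WithBot ℕ∞) := by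
  exact ⟨hR.existsUnique_isHilbertPolynomial, fun P hP J =>
    hR.topologicalKrullDim_range_projection_eq_degreeIn hX hP J⟩
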